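/- **Bilateral binomial duplication formula.** For $a\in\mathbb{C}$ and an integer $m$ let $(a)_m$ be the shifted factorial: $(a)_n=a(a+1)\cdots(a+n-1)$ and $(a)_{-n}=\dfrac{1}{(a-1)(a-2)\cdots(a-n)}$ for integers $n\ge 0$. Let $${}_2H_2\left[\begin{matrix} a, b\\ c, d\end{matrix}; z\right]=\sum_{m=-\infty}^{\infty}\frac{(a)_m(b)_m}{(c)_m(d)_m}\,z^m$$ be the bilateral hypergeometric series, its value being the limit of the partial sums over $-M\le m\le N$ as $M,N\to\infty$ independently. (If $c$ is a positive integer, $1/(c)_{-n}$ means the product $(c-1)\cdots(c-n)$, and likewise for $d$.) Let $a,c,z\in\mathbb{C}$ with $|z|=1$, $2a\notin\{1,2,3,\dots\}$ and $2c\notin\{0,-1,-2,\dots\}$. Suppose that $\operatorname{Re}(c-a)>\tfrac12$, or that $\operatorname{Re}(c-a)>0$ and $z\ne 1$. Then the series ${}_2H_2[a,a+\tfrac12;\,c,c+\tfrac12;\,z]$ converges, absolutely if $\operatorname{Re}(c-a)>\tfrac12$, and for each of the two square roots $\sqrt z$ of $z$ $${}_2H_2\left[\begin{matrix} a, a+\tfrac12\\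 c, c+\tfrac12\end{matrix}; z\right]=\frac{\Gamma(2c)\,\Gamma(1-2a)}{2\,\Gamma(2c-2a)}\left(\frac{(1+\sqrt z)^{2c-2a-1}}{(\sqrt z)^{2c-1}}+\frac{(1-\sqrt z)^{2c-2a-1}}{(-\sqrt z)^{2c-1}}\right).$$ All complex powers are principal values ($-\pi<\arg\le\pi$), and $0^{w}=0$ for $w\neq 0$. In particular the right-hand side does not depend on which square root of $z$ is taken. -/

import Mathlib

/-- The shifted factorial `(a)_m` for an integer index `m`:
`(a)_n = a (a + 1) ⋯ (a + n - 1)` and `(a)_{-n} = 1 / ((a - n) (a - n + 1) ⋯ (a - 1))`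
for natural numbers `n`. -/
noncomputable def shiftedFactorial (a : ℂ) : ℤ → ℂ
  | Int.ofNat n => ∏ i ∈ Finset.range n, (a + i)
  | Int.negSucc n => (∏ i ∈ Finset.range (n + 1), (a - (i + 1)))⁻¹

/-- The term of index `m` of the bilateral hypergeometric series `₂H₂[a, b; c, d; z]`.

If `c` is a positive integer and `m ≤ -c`, the factor `1 / (c)_m` is the product
`(c - 1) (c - 2) ⋯ (c + m)`, which contains the factor `0`; the conventions `0⁻¹ = 0` and `x / 0 = 0`
return this value `0` (and likewise for `d`). -/
noncomputable def bilateralTerm (a b c d z : ℂ) (m : ℤ) : ℂ :=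
  shiftedFactorial a m * shiftedFactorial b m /
    (shiftedFactorial c m * shiftedFactorial d m) * z ^ m

/-- The bilateral hypergeometric series `₂H₂[a, b; c, d; z]`: the limit of the partial sums
over `-M ≤ m ≤ N` as `M` and `N` tend to infinity independently of each other. -/
noncomputable def bilateralH (a b c d z : ℂ) : ℂ :=
  ∑'[SummationFilter.conditional ℤ] m, bilateralTerm a b c d z m

open Complex MeasureTheory Filter Topology SummationFilter

/-! By Legendre duplication the `m`-th term of the `₂H₂` series is `(2a)_{2m} / (2c)_{2m} * z ^ m`,
so with `s ^ 2 = z` the series is the even part at `s` of the bilateral binomial series `∑ (A)_n /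
(C)_n * x ^ n`, `A = 2a`, `C = 2c`. It remains to sum that series on `‖x‖ = 1`.

For `Re (C - A) > 1` it is, up to a constant, the Fourier series of `(1 + e^{iy})^{C-A-1}
e^{-i(C-1)y}` on `(-π, π]` at `e^{iy} = -x`. The coefficients are given by Cauchy's beta integral
(`integral_one_add_exp_cpow`) and are absolutely summable (`hasSum_hornCoeff_of_one_lt`).

For `Re (C - A) > 0` and `x ≠ 1`, multiplication by `1 - x` telescopes the series into the one with
`C + 1` in place of `C`, which converges absolutely (`hasSum_conditional_hornCoeff`). -/

/-! ### Cauchy's beta integral -/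

theorem one_add_eq_zero_or_re_pos {u : ℂ} (hu : ‖u‖ ≤ 1) : 1 + u = 0 ∨ 0 < (1 + u).re := by
  by_cases h : 0 < (1 + u).re
  · exact Or.inr h
  · left
    have h1 : u.re ≤ -1 := by simp at h; linarith
    have h2 : u.re ^ 2 + u.im ^ 2 ≤ 1 := by
      have := Complex.sq_norm u
      rw [Complex.normSq_apply] at this
      nlinarith [norm_nonneg u]
    have h3 : u.im = 0 := by nlinarith [sq_nonneg u.im]
    have h4 : u.re = -1 := by nlinarith
    apply Complex.ext <;> simp [h3, h4]

/-- On the closed disc `1 + u` stays in the right half-plane, away from the branch cut, except at `u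
= -1`, where `0 < p.re` gives continuity. -/
theorem continuousOn_one_add_cpow {p : ℂ} (hp : 0 < p.re) :
    ContinuousOn (fun u : ℂ => (1 + u) ^ p) (Metric.closedBall 0 1) := by
  intro u hu
  have hu' : ‖u‖ ≤ 1 := by simpa using hu
  have hadd : ContinuousAt (fun u : ℂ => 1 + u) u := by fun_prop
  apply ContinuousAt.continuousWithinAt
  rcases one_add_eq_zero_or_re_pos hu' with h | h
  · have h0 : ContinuousAt (fun v : ℂ => v ^ p) (1 + u) := by
      rw [h]
      exact (Complex.continuousAt_cpow_zero_of_re_pos hp).comp (f := fun v : ℂ => (v, p))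
        (by fun_prop)
    exact h0.comp (f := fun u : ℂ => 1 + u) hadd
  · exact hadd.cpow continuousAt_const (Or.inl h)

theorem norm_exp_le_one {ζ : ℂ} (h : ζ.re ≤ 0) : ‖exp ζ‖ ≤ 1 := by
  rw [Complex.norm_exp]; exact Real.exp_le_one_iff.2 h

theorem continuousOn_one_add_exp_cpow {p : ℂ} (hp : 0 < p.re) (w : ℂ) :
    ContinuousOn (fun ζ : ℂ => (1 + exp ζ) ^ p * exp (-w * ζ)) {ζ | ζ.re ≤ 0} := by
  refine ContinuousOn.mul ?_ (by fun_prop)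
  exact (continuousOn_one_add_cpow hp).comp (by fun_prop)
    fun ζ hζ => by simpa using norm_exp_le_one hζ

theorem continuous_one_add_exp_mul_I_cpow {p : ℂ} (hp : 0 < p.re) :
    Continuous (fun y : ℝ => (1 + exp (y * I)) ^ p) :=
  (continuousOn_one_add_cpow hp).comp_continuous (by fun_prop)
    fun y => by simp [Complex.norm_exp_ofReal_mul_I]

/-- The substitution `t = e^x` produces a truncated beta integral; the exponent `p + 1 - 1` matches
the form of `betaIntegral (-w) (p + 1)`. -/
theorem integral_horizontal {p w : ℂ} (hp : 0 < p.re) (R : ℝ) (hR : 0 ≤ R) :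
    ∫ x : ℝ in -R..0, (1 - exp x) ^ p * exp (-w * x) =
      ∫ t : ℝ in Real.exp (-R)..1, (t : ℂ) ^ (-w - 1) * (1 - t) ^ (p + 1 - 1) := by
  have := intervalIntegral.integral_deriv_smul_comp'' (a := -R) (b := 0) (f := Real.exp)
    (f' := Real.exp) (g := fun t : ℝ => (t : ℂ) ^ (-w - 1) * (1 - (t : ℂ)) ^ (p + 1 - 1))
    (by fun_prop) (fun x _ => (Real.hasDerivAt_exp x).hasDerivWithinAt) (by fun_prop) ?_
  · rw [Real.exp_zero] at this
    rw [← this]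
    refine intervalIntegral.integral_congr fun x _ => ?_
    have hx : (Real.exp x : ℂ) ≠ 0 := by exact_mod_cast (Real.exp_pos x).ne'
    simp only [Function.comp, add_sub_cancel_right, real_smul]
    rw [Complex.cpow_sub _ _ hx, Complex.cpow_one, Complex.cpow_def_of_ne_zero hx,
      ← Complex.ofReal_log (Real.exp_pos x).le, Real.log_exp, ← Complex.ofReal_exp]
    field_simp
  · rintro t ⟨x, hx, rfl⟩
    rw [Set.uIcc_of_le (by linarith)] at hx
    apply ContinuousWithinAt.mul
    · apply ContinuousAt.continuousWithinAt
      exact Complex.continuous_ofReal.continuousAt.cpow continuousAt_const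
        (Or.inl (by simpa only [ofReal_re] using Real.exp_pos x))
    · have h1 : ContinuousOn (fun t : ℝ => (1 + (-t : ℂ)) ^ (p + 1 - 1)) (Set.Icc 0 1) := by
        refine (continuousOn_one_add_cpow (p := p + 1 - 1) (by simpa using hp)).comp
          (f := fun t : ℝ => -(t : ℂ)) (by fun_prop) fun t ht => ?_
        simp only [Metric.mem_closedBall, dist_zero_right, norm_neg, norm_real, Real.norm_eq_abs]
        exact abs_le.2 ⟨by linarith [ht.1], ht.2⟩
      simp only [← sub_eq_add_neg] at h1
      refine (h1 (Real.exp x) ⟨(Real.exp_pos x).le, Real.exp_le_one_iff.2 hx.2⟩).mono ?_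
      rintro _ ⟨y, hy, rfl⟩
      rw [Set.uIcc_of_le (by linarith)] at hy
      exact ⟨(Real.exp_pos y).le, Real.exp_le_one_iff.2 hy.2⟩

/-- Cauchy's theorem on `[-R, 0] × [-π, π]`. On the horizontal edges `e^{x ± iπ} = -e^x`, so their
integrands differ only by the factors `e^{∓iπw}`. The integrand need only be continuous on the
boundary, which contains the branch points `±iπ`. -/
theorem integral_one_add_exp_cpow_rect {p w : ℂ} (hp : 0 < p.re) (R : ℝ) (hR : 0 ≤ R) :
    (exp (Real.pi * I * w) - exp (-(Real.pi * I * w))) *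
        (∫ x : ℝ in -R..0, (1 - exp x) ^ p * exp (-w * x)) +
      I * (∫ y : ℝ in -Real.pi..Real.pi, (1 + exp (y * I)) ^ p * exp (-w * (y * I))) -
      I * (∫ y : ℝ in -Real.pi..Real.pi,
        (1 + exp (-R + y * I)) ^ p * exp (-w * (-R + y * I))) = 0 := by
  have key := Complex.integral_boundary_rect_eq_zero_of_continuousOn_of_differentiableOn
    (fun ζ : ℂ => (1 + exp ζ) ^ p * exp (-w * ζ)) (-R + (-Real.pi : ℝ) * I) (Real.pi * I)
    ((continuousOn_one_add_exp_cpow hp w).mono ?_) ?_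
  · simp only [add_re, neg_re, ofReal_re, mul_re, I_re, mul_zero, ofReal_im, I_im,
      add_zero, add_im, neg_im, mul_im, mul_one, zero_add, neg_zero,
      smul_eq_mul, ofReal_neg, ofReal_zero, sub_self] at key
    rw [← key, sub_mul, ← intervalIntegral.integral_const_mul, ← intervalIntegral.integral_const_mul]
    congr 2
    · refine congrArg₂ (· - ·) (intervalIntegral.integral_congr fun x _ => ?_)
        (intervalIntegral.integral_congr fun x _ => ?_)
      · have h1 : exp (x + -(Real.pi : ℂ) * I) = -exp x := by
          rw [Complex.exp_add, neg_mul, Complex.exp_neg, Complex.exp_pi_mul_I]; simp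
        simp only [h1]
        rw [← sub_eq_add_neg, mul_left_comm, ← Complex.exp_add]
        congr 2; ring
      · have h1 : exp (x + (Real.pi : ℂ) * I) = -exp x := by
          rw [Complex.exp_add, Complex.exp_pi_mul_I]; simp
        simp only [h1]
        rw [← sub_eq_add_neg, mul_left_comm, ← Complex.exp_add]
        congr 2; ring
  · intro ζ hζ
    have := hζ.1
    simp [Set.uIcc_of_le, hR] at this
    simpa using this.2
  · intro ζ hζ
    have h1 := hζ.1
    simp [hR] at h1
    apply DifferentiableAt.differentiableWithinAt
    refine DifferentiableAt.mul ?_ (by fun_prop)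
    refine DifferentiableAt.cpow (by fun_prop) (by fun_prop) ?_
    refine Complex.mem_slitPlane_of_norm_lt_one ?_
    rw [Complex.norm_exp]
    exact Real.exp_lt_one_iff.2 h1.2

theorem tendsto_integral_vertical {p w : ℂ} (hp : 0 < p.re) (hw : w.re < 0) :
    Tendsto (fun R : ℝ => ∫ y : ℝ in -Real.pi..Real.pi,
        (1 + exp (-R + y * I)) ^ p * exp (-w * (-R + y * I))) atTop (𝓝 0) := by
  obtain ⟨M, hM⟩ := (isCompact_closedBall (0 : ℂ) 1).exists_bound_of_continuousOn
    (continuousOn_one_add_cpow hp)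
  have hM0 : 0 ≤ M := (norm_nonneg _).trans (hM 0 (by simp))
  -- The exponent bounds `Re (-w (-R + iy)) = w.re * R + w.im * y` for `|y| ≤ π`.
  have hlim : Tendsto (fun R : ℝ => M * Real.exp (w.re * R + |w.im| * Real.pi) *
      |Real.pi - -Real.pi|) atTop (𝓝 0) := by
    have : Tendsto (fun R : ℝ => w.re * R + |w.im| * Real.pi) atTop atBot :=
      tendsto_atBot_add_const_right _ _ (tendsto_id.const_mul_atTop_of_neg hw)
    simpa using ((Real.tendsto_exp_atBot.comp this).const_mul M).mul_const |Real.pi - -Real.pi|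
  refine squeeze_zero_norm' ?_ hlim
  filter_upwards [eventually_ge_atTop 0] with R hR
  refine intervalIntegral.norm_integral_le_of_norm_le_const fun y hy => ?_
  rw [Set.uIoc_of_le (by linarith [Real.pi_pos])] at hy
  rw [norm_mul]
  gcongr
  · refine hM _ ?_
    simpa using norm_exp_le_one (ζ := -R + y * I) (by simpa using hR)
  · rw [Complex.norm_exp]
    gcongr
    have : w.im * y ≤ |w.im| * Real.pi := by
      calc w.im * y ≤ |w.im * y| := le_abs_self _
        _ = |w.im| * |y| := abs_mul _ _
        _ ≤ _ := by gcongr; exact abs_le.2 ⟨hy.1.le, hy.2⟩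
    simp
    linarith

theorem inv_Gamma_mul_sin (w : ℂ) (hw : w.re < 0) :
    -2 * sin (Real.pi * w) * Gamma (-w) = 2 * Real.pi * (Gamma (1 + w))⁻¹ := by
  have h := Complex.Gamma_mul_Gamma_one_sub (-w)
  have hG : Gamma (-w) ≠ 0 := Complex.Gamma_ne_zero_of_re_pos (by simpa using hw)
  have hpi : (Real.pi : ℂ) ≠ 0 := by exact_mod_cast Real.pi_ne_zero
  rw [sub_neg_eq_add, mul_neg, Complex.sin_neg] at h
  -- If the sine vanishes, `1 + w` is a pole of `Gamma`, where `Gamma` takes the value `0`, and both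
  -- sides are `0`.
  by_cases hs : sin (Real.pi * w) = 0
  · rw [hs] at h ⊢
    have : Gamma (1 + w) = 0 := by simpa [hG] using h
    simp [this]
  · have hG' : Gamma (1 + w) ≠ 0 := by
      intro h0
      rw [h0, mul_zero, eq_comm, div_eq_zero_iff] at h
      rcases h with h | h
      · exact hpi h
      · exact hs (neg_eq_zero.1 h)
    rw [eq_div_iff (neg_ne_zero.2 hs)] at h
    field_simp
    linear_combination h

theorem integral_one_add_exp_cpow_of_re_neg {p w : ℂ} (hp : 0 < p.re) (hw : w.re < 0) :
    ∫ y : ℝ in -Real.pi..Real.pi, (1 + exp (y * I)) ^ p * exp (-w * (y * I)) =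
      2 * Real.pi * Gamma (p + 1) * ((Gamma (1 + w))⁻¹ * (Gamma (1 + p - w))⁻¹) := by
  have hu : 0 < (-w).re := by simpa using hw
  have hv : 0 < (p + 1).re := by simp; linarith
  have hB : Tendsto (fun R : ℝ => ∫ t : ℝ in Real.exp (-R)..1,
      (t : ℂ) ^ (-w - 1) * (1 - t) ^ (p + 1 - 1)) atTop (𝓝 (betaIntegral (-w) (p + 1))) := by
    have hint := betaIntegral_convergent hu hv
    have hc := intervalIntegral.continuousOn_primitive_interval' hint
      (b₁ := 0) (b₂ := 1) (a := 1) (by simp)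
    have h0 := hc 0 (by simp)
    rw [Set.uIcc_of_le zero_le_one] at h0
    have ht : Tendsto (fun R : ℝ => Real.exp (-R)) atTop (𝓝[Set.Icc 0 1] 0) := by
      refine tendsto_nhdsWithin_iff.2 ⟨Real.tendsto_exp_neg_atTop_nhds_zero, ?_⟩
      filter_upwards [eventually_ge_atTop 0] with R hR
      exact ⟨(Real.exp_pos _).le, Real.exp_le_one_iff.2 (by linarith)⟩
    have := (h0.tendsto.comp ht).neg
    simp only [Function.comp_def, ← intervalIntegral.integral_symm] at this
    exact this
  have hlim := ((hB.const_mul (exp (Real.pi * I * w) - exp (-(Real.pi * I * w)))).add_const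
    (I * (∫ y : ℝ in -Real.pi..Real.pi, (1 + exp (y * I)) ^ p * exp (-w * (y * I))))).sub
    ((tendsto_integral_vertical hp hw).const_mul I)
  have hzero := tendsto_nhds_unique (hlim.congr' (f₂ := fun _ => (0 : ℂ)) ?_) tendsto_const_nhds
  · have hG := Complex.Gamma_mul_Gamma_eq_betaIntegral hu hv
    have hG0 : Gamma (1 + p - w) ≠ 0 := Complex.Gamma_ne_zero_of_re_pos (by simp; linarith)
    rw [show -w + (p + 1) = 1 + p - w by ring] at hG
    have hsin : exp (Real.pi * I * w) - exp (-(Real.pi * I * w)) = 2 * I * sin (Real.pi * w) := by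
      rw [Complex.sin, show Real.pi * I * w = Real.pi * w * I by ring,
        show -(Real.pi * w) * I = -(Real.pi * w * I) by ring]
      linear_combination (exp (Real.pi * w * I) - exp (-(Real.pi * w * I))) * I_sq
    have hs := inv_Gamma_mul_sin w hw
    rw [hsin] at hzero
    have hB' : betaIntegral (-w) (p + 1) = Gamma (-w) * Gamma (p + 1) * (Gamma (1 + p - w))⁻¹ := by
      rw [hG]; field_simp
    rw [hB'] at hzero
    apply mul_left_cancel₀ I_ne_zero
    linear_combination hzero + I * Gamma (p + 1) * (Gamma (1 + p - w))⁻¹ * hs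
  · filter_upwards [eventually_ge_atTop 0] with R hR
    rw [← integral_horizontal hp R hR]
    exact integral_one_add_exp_cpow_rect hp R hR

theorem differentiable_integral_mul_exp {g : ℝ → ℂ} (hg : Continuous g) :
    Differentiable ℂ (fun w : ℂ => ∫ y : ℝ in -Real.pi..Real.pi, g y * exp (-w * (y * I))) := by
  intro w₀
  obtain ⟨K, hK⟩ := ((isCompact_closedBall w₀ 1).prod
    (isCompact_Icc (a := -Real.pi) (b := Real.pi))).exists_bound_of_continuousOn
    (f := fun q : ℂ × ℝ => g q.2 * (exp (-q.1 * (q.2 * I)) * -(q.2 * I))) (by fun_prop)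
  refine (intervalIntegral.hasDerivAt_integral_of_dominated_loc_of_deriv_le
    (F' := fun w y => g y * (exp (-w * (y * I)) * -(y * I))) (bound := fun _ => K)
    (Metric.closedBall_mem_nhds w₀ one_pos) ?_ ?_ ?_ ?_ ?_ ?_).2.differentiableAt
  · exact Eventually.of_forall fun w => Continuous.aestronglyMeasurable (by fun_prop)
  · exact Continuous.intervalIntegrable (by fun_prop) _ _
  · exact Continuous.aestronglyMeasurable (by fun_prop)
  · refine ae_of_all _ fun y hy w hw => hK (w, y) ⟨hw, ?_⟩
    rw [Set.uIoc_of_le (by linarith [Real.pi_pos])] at hy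
    exact ⟨hy.1.le, hy.2⟩
  · exact intervalIntegrable_const
  · refine ae_of_all _ fun y _ w _ => ?_
    have := ((hasDerivAt_id w).neg.mul_const (y * I)).cexp.const_mul (g y)
    simpa using this

/-- Cauchy's beta integral. -/
theorem integral_one_add_exp_cpow {p : ℂ} (hp : 0 < p.re) (w : ℂ) :
    ∫ y : ℝ in -Real.pi..Real.pi, (1 + exp (y * I)) ^ p * exp (-w * (y * I)) =
      2 * Real.pi * Gamma (p + 1) * ((Gamma (1 + w))⁻¹ * (Gamma (1 + p - w))⁻¹) := by
  -- Both sides are entire in `w`, so agreement near `w = -1` suffices.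
  have h1 := differentiable_integral_mul_exp (continuous_one_add_exp_mul_I_cpow hp)
  have h2 : Differentiable ℂ (fun w : ℂ =>
      2 * Real.pi * Gamma (p + 1) * ((Gamma (1 + w))⁻¹ * (Gamma (1 + p - w))⁻¹)) := by
    refine Differentiable.const_mul (Differentiable.mul ?_ ?_) _
    · exact Complex.differentiable_one_div_Gamma.comp (f := fun w : ℂ => 1 + w) (by fun_prop)
    · exact Complex.differentiable_one_div_Gamma.comp (f := fun w : ℂ => 1 + p - w) (by fun_prop)
  have := (analyticOnNhd_univ_iff_differentiable.2 h1).eq_of_eventuallyEq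
    (analyticOnNhd_univ_iff_differentiable.2 h2) (z₀ := -1) ?_
  · exact congrFun this w
  · filter_upwards [(isOpen_lt continuous_re continuous_const).mem_nhds
      (show (-1 : ℂ).re < 0 by simp)] with w hw
    exact integral_one_add_exp_cpow_of_re_neg hp hw

/-! ### Coefficients of the bilateral binomial series -/

theorem inv_Gamma_eq_prod_mul (s : ℂ) (n : ℕ) :
    (Gamma s)⁻¹ = (∏ i ∈ Finset.range n, (s + i)) * (Gamma (s + n))⁻¹ := by
  induction n with
  | zero => simp
  | succ n ih =>
    rw [ih, Finset.prod_range_succ, Complex.one_div_Gamma_eq_self_mul_one_div_Gamma_add_one (s + n)]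
    push_cast
    rw [mul_assoc, add_assoc s]

/-- The coefficient of `x ^ n` in the bilateral series `₁H₁[A; C; x]`, written with the Gamma
function. -/
noncomputable def hornCoeff (A C : ℂ) (n : ℤ) : ℂ :=
  (-1) ^ n * (Gamma C * Gamma (1 - A)) * ((Gamma (C + n))⁻¹ * (Gamma (1 - A - n))⁻¹)

/-- This reflection preserves `C - A`, so estimates at `-∞` reduce to those at `+∞`. -/
theorem hornCoeff_neg (A C : ℂ) (n : ℤ) : hornCoeff A C (-n) = hornCoeff (1 - C) (1 - A) n := by
  have : (-1 : ℂ) ^ (-n) = (-1) ^ n := by rw [zpow_neg, ← inv_zpow]; norm_num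
  simp only [hornCoeff, this, sub_sub_cancel, Int.cast_neg, sub_neg_eq_add, ← sub_eq_add_neg]
  ring

theorem Gamma_mul_inv_Gamma_add_natCast {C : ℂ} (hC : ∀ j : ℕ, C ≠ -j) (n : ℕ) :
    Gamma C * (Gamma (C + n))⁻¹ = (∏ i ∈ Finset.range n, (C + i))⁻¹ := by
  have h0 : Gamma C ≠ 0 := Complex.Gamma_ne_zero hC
  have h := inv_Gamma_eq_prod_mul C n
  have hp : ∏ i ∈ Finset.range n, (C + i) ≠ 0 :=
    Finset.prod_ne_zero_iff.2 fun i _ hi => hC i (eq_neg_of_add_eq_zero_left hi)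
  field_simp at h ⊢
  rw [h]

theorem inv_Gamma_sub_natCast (B : ℂ) (n : ℕ) :
    (Gamma (B - n))⁻¹ = (∏ i ∈ Finset.range n, (B - (i + 1))) * (Gamma B)⁻¹ := by
  rw [inv_Gamma_eq_prod_mul (B - n) n, sub_add_cancel, ← Finset.prod_range_reflect]
  congr 1
  refine Finset.prod_congr rfl fun i hi => ?_
  have : i + 1 ≤ n := Finset.mem_range.1 hi
  rw [show n - 1 - i = n - (i + 1) by omega, Nat.cast_sub this]
  push_cast; ring

theorem hornCoeff_natCast {A C : ℂ} (hA : ∀ j : ℕ, A ≠ j + 1) (hC : ∀ j : ℕ, C ≠ -j) (n : ℕ) :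
    hornCoeff A C n =
      (∏ i ∈ Finset.range n, (A + i)) / ∏ i ∈ Finset.range n, (C + i) := by
  have h1 := Gamma_mul_inv_Gamma_add_natCast hC n
  have h2 := inv_Gamma_sub_natCast (1 - A) n
  have h0 : Gamma (1 - A) ≠ 0 := Complex.Gamma_ne_zero fun m hm => hA m (by linear_combination -hm)
  have h3 : ∏ i ∈ Finset.range n, (1 - A - (i + 1)) =
      (-1) ^ n * ∏ i ∈ Finset.range n, (A + i) := by
    nth_rw 2 [← Finset.card_range n]
    rw [← Finset.prod_const, ← Finset.prod_mul_distrib]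
    exact Finset.prod_congr rfl fun i _ => by ring
  have h4 : ((-1 : ℂ) ^ n) * (-1) ^ n = 1 := by rw [← mul_pow]; simp
  rw [hornCoeff, Int.cast_natCast, zpow_natCast, h2, h3, div_eq_mul_inv, ← h1]
  field_simp
  linear_combination (∏ i ∈ Finset.range n, (A + i)) * Gamma C * (Gamma (C + n))⁻¹ * h4

/-- The quotient is `n ^ (A - C)` times a ratio of Euler's sequences `GammaSeq`, which converges; if
`A` is a pole of `Gamma`, the numerator is eventually `0`. -/
theorem isBigO_prod_div_prod (A : ℂ) {C : ℂ} (hC : ∀ j : ℕ, C ≠ -j) :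
    (fun n : ℕ => (∏ i ∈ Finset.range (n + 1), (A + i)) / ∏ i ∈ Finset.range (n + 1), (C + i))
      =O[atTop] fun n : ℕ => (n : ℝ) ^ (A - C).re := by
  by_cases hA : ∃ j : ℕ, A = -j
  · obtain ⟨j, rfl⟩ := hA
    refine (Asymptotics.isBigO_zero (E' := ℂ) _ _).congr' ?_ EventuallyEq.rfl
    filter_upwards [eventually_ge_atTop j] with n hn
    rw [Finset.prod_eq_zero (Finset.mem_range.2 (Nat.lt_succ_of_le hn)) (by simp), zero_div]
  · push Not at hA
    have hprod : ∀ {B : ℂ}, (∀ j : ℕ, B ≠ -j) → ∀ n : ℕ, ∏ i ∈ Finset.range n, (B + i) ≠ 0 :=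
      fun hB n => Finset.prod_ne_zero_iff.2 fun i _ hi => hB i (eq_neg_of_add_eq_zero_left hi)
    have hlim : Tendsto (fun n => GammaSeq C n / GammaSeq A n) atTop (𝓝 (Gamma C / Gamma A)) :=
      (GammaSeq_tendsto_Gamma C).div (GammaSeq_tendsto_Gamma A) (Complex.Gamma_ne_zero hA)
    have hpow : (fun n : ℕ => (n : ℂ) ^ (A - C)) =O[atTop] fun n : ℕ => (n : ℝ) ^ (A - C).re := by
      refine Asymptotics.IsBigO.of_bound 1 ?_
      filter_upwards [eventually_gt_atTop 0] with n hn
      rw [Complex.norm_natCast_cpow_of_pos hn, Real.norm_of_nonneg (by positivity), one_mul]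
    refine ((hpow.mul (hlim.isBigO_one ℝ)).congr' ?_ (by simp))
    filter_upwards [eventually_gt_atTop 0] with n hn
    have hn' : (n : ℂ) ≠ 0 := by exact_mod_cast hn.ne'
    have hA1 := hprod hA (n + 1)
    have hC1 := hprod hC (n + 1)
    have hf : (n.factorial : ℂ) ≠ 0 := by exact_mod_cast n.factorial_ne_zero
    have hAn : (n : ℂ) ^ A ≠ 0 := by simp [Complex.cpow_eq_zero_iff, hn']
    have hCn : (n : ℂ) ^ C ≠ 0 := by simp [Complex.cpow_eq_zero_iff, hn']
    rw [GammaSeq, GammaSeq, Complex.cpow_sub _ _ hn']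
    field_simp

theorem isBigO_hornCoeff_natCast {A C : ℂ} (hA : ∀ j : ℕ, A ≠ j + 1) (hC : ∀ j : ℕ, C ≠ -j) :
    (fun n : ℕ => hornCoeff A C ((n + 1 : ℕ) : ℤ)) =O[atTop]
      fun n : ℕ => (n : ℝ) ^ (A - C).re := by
  simp only [hornCoeff_natCast hA hC]
  exact isBigO_prod_div_prod A hC

theorem summable_hornCoeff_natCast {A C : ℂ} (hA : ∀ j : ℕ, A ≠ j + 1) (hC : ∀ j : ℕ, C ≠ -j)
    (h : 1 < (C - A).re) : Summable fun n : ℕ => hornCoeff A C n := by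
  rw [← summable_nat_add_iff 1]
  refine summable_of_isBigO_nat (Real.summable_nat_rpow.2 ?_) (isBigO_hornCoeff_natCast hA hC)
  simp only [sub_re] at h ⊢
  linarith

theorem summable_hornCoeff {A C : ℂ} (hA : ∀ j : ℕ, A ≠ j + 1) (hC : ∀ j : ℕ, C ≠ -j)
    (h : 1 < (C - A).re) : Summable (hornCoeff A C) := by
  refine Summable.of_nat_of_neg (summable_hornCoeff_natCast hA hC h) ?_
  simp only [hornCoeff_neg]
  refine summable_hornCoeff_natCast (fun j hj => hC j ?_) (fun j hj => hA j ?_) ?_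
  · linear_combination -hj
  · linear_combination -hj
  · rwa [show 1 - A - (1 - C) = C - A by ring]

theorem tendsto_hornCoeff_atTop {A C : ℂ} (hA : ∀ j : ℕ, A ≠ j + 1) (hC : ∀ j : ℕ, C ≠ -j)
    (h : 0 < (C - A).re) : Tendsto (hornCoeff A C) atTop (𝓝 0) := by
  rw [← Nat.map_cast_int_atTop, tendsto_map'_iff]
  refine (tendsto_add_atTop_iff_nat 1).1 ?_
  refine (isBigO_hornCoeff_natCast hA hC).trans_tendsto ?_
  have : (A - C).re = -(C - A).re := by simp
  rw [this]
  exact (tendsto_rpow_neg_atTop h).comp tendsto_natCast_atTop_atTop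

theorem tendsto_hornCoeff_atBot {A C : ℂ} (hA : ∀ j : ℕ, A ≠ j + 1) (hC : ∀ j : ℕ, C ≠ -j)
    (h : 0 < (C - A).re) : Tendsto (hornCoeff A C) atBot (𝓝 0) := by
  have := (tendsto_hornCoeff_atTop (A := 1 - C) (C := 1 - A) (fun j hj => hC j ?_)
    (fun j hj => hA j ?_) ?_).comp tendsto_neg_atBot_atTop
  · refine this.congr fun n => ?_
    rw [Function.comp_apply, ← hornCoeff_neg, neg_neg]
  · linear_combination -hj
  · linear_combination -hj
  · rwa [show 1 - A - (1 - C) = C - A by ring]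

/-- Differencing raises `C` by one and so gains one power of decay. -/
theorem hornCoeff_sub_hornCoeff {A C : ℂ} (hC : C ≠ 0) (n : ℤ) :
    hornCoeff A C n - hornCoeff A C (n - 1) =
      (A - C) / C * hornCoeff A (C + 1) (n - 1) := by
  have h1 := Complex.one_div_Gamma_eq_self_mul_one_div_Gamma_add_one (C + n - 1)
  have h2 := Complex.one_div_Gamma_eq_self_mul_one_div_Gamma_add_one (1 - A - n)
  have h3 : (-1 : ℂ) ^ (n - 1) = -(-1) ^ n := by rw [zpow_sub_one₀ (by norm_num)]; norm_num
  rw [sub_add_cancel] at h1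
  simp only [hornCoeff, h3, Int.cast_sub, Int.cast_one]
  rw [show C + ((n : ℂ) - 1) = C + n - 1 by ring, show 1 - A - ((n : ℂ) - 1) = 1 - A - n + 1 by ring,
    show C + 1 + ((n : ℂ) - 1) = C + n by ring, h1, h2, Complex.Gamma_add_one C hC]
  field_simp
  ring

/-! ### The bilateral binomial theorem on the unit circle -/

/-- The sum of the bilateral series `₁H₁[A; C; x]` on the unit circle. -/
noncomputable def hornSum (A C x : ℂ) : ℂ :=
  Gamma C * Gamma (1 - A) / Gamma (C - A) * ((1 - x) ^ (C - A - 1) / (-x) ^ (C - 1))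

theorem fourierCoeff_one_add_exp_cpow [Fact (0 < 2 * Real.pi)] {p : ℂ} (hp : 0 < p.re) (q : ℂ)
    (n : ℤ) :
    fourierCoeff (AddCircle.liftIoc (2 * Real.pi) (-Real.pi)
      fun y : ℝ => (1 + exp (y * I)) ^ p * exp (-q * (y * I))) n =
      Gamma (p + 1) * ((Gamma (1 + q + n))⁻¹ * (Gamma (1 + p - q - n))⁻¹) := by
  rw [fourierCoeff_liftIoc_eq, fourierCoeffOn_eq_integral]
  have hend : -Real.pi + 2 * Real.pi = Real.pi := by ring
  have hlen : Real.pi - -Real.pi = 2 * Real.pi := by ring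
  have hpi : (Real.pi : ℂ) ≠ 0 := by exact_mod_cast Real.pi_ne_zero
  have hint := integral_one_add_exp_cpow hp (q + n)
  simp only [fourier_coe_apply, hend, hlen, smul_eq_mul, real_smul]
  rw [show 1 + q + (n : ℂ) = 1 + (q + n) by ring, show 1 + p - q - (n : ℂ) = 1 + p - (q + n) by ring]
  trans (1 / (2 * Real.pi) : ℂ) * ∫ y : ℝ in -Real.pi..Real.pi,
    (1 + exp (y * I)) ^ p * exp (-(q + n) * (y * I))
  · push_cast
    congr 1
    refine intervalIntegral.integral_congr fun y _ => ?_
    rw [mul_left_comm, ← Complex.exp_add]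
    congr 2
    field_simp
    ring
  · rw [hint]; field_simp

theorem hasSum_hornCoeff_of_one_lt {A C x : ℂ} (hA : ∀ j : ℕ, A ≠ j + 1) (hC : ∀ j : ℕ, C ≠ -j)
    (h : 1 < (C - A).re) (hx : ‖x‖ = 1) :
    HasSum (fun n : ℤ => hornCoeff A C n * x ^ n) (hornSum A C x) := by
  have : Fact (0 < 2 * Real.pi) := ⟨Real.two_pi_pos⟩
  have hp : 0 < (C - A - 1).re := by simp only [sub_re, one_re] at h ⊢; linarith
  have hp0 : C - A - 1 ≠ 0 := fun h0 => by simp [h0] at hp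
  set f : ℝ → ℂ := fun y => (1 + exp (y * I)) ^ (C - A - 1) * exp (-(C - 1) * (y * I)) with hf
  have hcont : Continuous f :=
    (continuous_one_add_exp_mul_I_cpow hp).mul (by fun_prop)
  -- Both values are `0`, since `1 + e^{±iπ} = 0` and the exponent is nonzero.
  have hper : f (-Real.pi) = f (-Real.pi + 2 * Real.pi) := by
    rw [show -Real.pi + 2 * Real.pi = Real.pi by ring]
    simp [hf, Complex.exp_neg, Complex.exp_pi_mul_I, hp0]
  set F : C(AddCircle (2 * Real.pi), ℂ) :=
    ⟨AddCircle.liftIoc (2 * Real.pi) (-Real.pi) f,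
      AddCircle.liftIoc_continuous hper hcont.continuousOn⟩ with hF
  have hGA : Gamma (C - A) ≠ 0 := Complex.Gamma_ne_zero_of_re_pos (by linarith)
  have hGC : Gamma C ≠ 0 := Complex.Gamma_ne_zero hC
  have hG1 : Gamma (1 - A) ≠ 0 := Complex.Gamma_ne_zero fun m hm => hA m (by linear_combination -hm)
  have hcoeff : ∀ n : ℤ, fourierCoeff F n =
      Gamma (C - A) / (Gamma C * Gamma (1 - A)) * ((-1) ^ n * hornCoeff A C n) := by
    intro n
    have h1 : ((-1 : ℂ) ^ n) * (-1) ^ n = 1 := by rw [← mul_zpow]; simp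
    have := fourierCoeff_one_add_exp_cpow hp (C - 1) n
    rw [show C - A - 1 + 1 = C - A by ring, show 1 + (C - 1) + (n : ℂ) = C + n by ring,
      show 1 + (C - A - 1) - (C - 1) - (n : ℂ) = 1 - A - n by ring] at this
    rw [hF, ContinuousMap.coe_mk, hf, this, hornCoeff]
    field_simp
    linear_combination -(Gamma (C + n))⁻¹ * (Gamma (1 - A - n))⁻¹ * h1
  have hsumm : Summable (fourierCoeff F) := by
    rw [funext hcoeff]
    refine Summable.mul_left _ (Summable.of_norm ?_)
    simpa using (summable_hornCoeff hA hC h).norm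
  have hx0 : x ≠ 0 := by rintro rfl; simp at hx
  -- Evaluation at `y = arg (-x)` in `(-π, π]` makes `e^{-i(C-1)y}` the principal value of
  -- `(-x)^{-(C-1)}`.
  have hxe : exp (arg (-x) * I) = -x := by
    have := Complex.norm_mul_exp_arg_mul_I (-x)
    simpa [hx] using this
  have hsum := has_pointwise_sum_fourier_series_of_summable hsumm
    ((arg (-x) : ℝ) : AddCircle (2 * Real.pi))
  have hval : F ((arg (-x) : ℝ) : AddCircle (2 * Real.pi)) =
      (1 - x) ^ (C - A - 1) / (-x) ^ (C - 1) := by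
    rw [hF, ContinuousMap.coe_mk, AddCircle.liftIoc_coe_apply, hf]
    · simp only
      rw [hxe, ← sub_eq_add_neg, Complex.cpow_def_of_ne_zero (neg_ne_zero.2 hx0),
        div_eq_mul_inv, ← Complex.exp_neg, Complex.log, norm_neg, hx]
      simp
      ring_nf
      simp
    · have := Complex.arg_mem_Ioc (-x)
      exact ⟨this.1, this.2.trans (by linarith)⟩
  rw [hval] at hsum
  have := hsum.mul_left (Gamma C * Gamma (1 - A) / Gamma (C - A))
  refine this.congr_fun ?_
  intro n
  have h1 : exp (2 * Real.pi * I * n * (arg (-x) : ℝ) / (2 * Real.pi : ℝ)) = (-1) ^ n * x ^ n := by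
    rw [← mul_zpow, neg_one_mul]
    conv_rhs => rw [← hxe]
    rw [← Complex.exp_int_mul]
    congr 1
    have hpi : (Real.pi : ℂ) ≠ 0 := by exact_mod_cast Real.pi_ne_zero
    push_cast
    field_simp
  have h2 : ((-1 : ℂ) ^ n) * (-1) ^ n = 1 := by rw [← mul_zpow]; simp
  rw [hcoeff, fourier_coe_apply, h1, smul_eq_mul]
  field_simp
  linear_combination -hornCoeff A C n * h2

/-- The closed form obeys the relation that the telescoping gives for the series. -/
theorem hornSum_eq_hornSum_add_one {A C x : ℂ} (hC : C ≠ 0) (hCA : C - A ≠ 0) (hx0 : x ≠ 0)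
    (hx1 : x ≠ 1) :
    (1 - x) * hornSum A C x = (A - C) / C * (x * hornSum A (C + 1) x) := by
  have h1 : 1 - x ≠ 0 := sub_ne_zero.2 hx1.symm
  have h2 : (-x) ^ C = (-x) ^ (C - 1) * -x := by
    rw [Complex.cpow_sub _ _ (neg_ne_zero.2 hx0), Complex.cpow_one,
      div_mul_cancel₀ _ (neg_ne_zero.2 hx0)]
  have h3 : (1 - x) ^ (C - A) = (1 - x) ^ (C - A - 1) * (1 - x) := by
    rw [Complex.cpow_sub (C - A) 1 h1, Complex.cpow_one, div_mul_cancel₀ _ h1]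
  have h4 : (-x) ^ (C - 1) ≠ 0 := by simp [Complex.cpow_eq_zero_iff, hx0]
  rw [hornSum, hornSum, show C + 1 - A = C - A + 1 by ring, Complex.Gamma_add_one _ hC,
    Complex.Gamma_add_one _ hCA, add_sub_cancel_right, add_sub_cancel_right, h2, h3]
  by_cases hG : Gamma (C - A) = 0
  · simp [hG]
  field_simp
  ring

theorem HasSum.conditional_int {f : ℤ → ℂ} {a : ℂ} (h : HasSum f a) :
    HasSum f a (conditional ℤ) :=
  Tendsto.mono_left h (LeAtTop.le_atTop (L := conditional ℤ))

theorem sum_Icc_sub_shift (g : ℤ → ℂ) {a b : ℤ} (hab : a ≤ b) :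
    ∑ n ∈ Finset.Icc a b, (g n - g (n - 1)) = g b - g (a - 1) := by
  induction b, hab using Int.leInduction with
  | base => simp
  | succ b hb ih =>
    have : Finset.Icc a (b + 1) = insert (b + 1) (Finset.Icc a b) := by
      ext m; simp only [Finset.mem_insert, Finset.mem_Icc]; omega
    rw [this, Finset.sum_insert (by simp), ih, add_sub_cancel_right]
    ring

theorem hasSum_conditional_hornCoeff {A C x : ℂ} (hA : ∀ j : ℕ, A ≠ j + 1)
    (hC : ∀ j : ℕ, C ≠ -j) (hx : ‖x‖ = 1) (h : 0 < (C - A).re) (hx1 : x ≠ 1) :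
    HasSum (fun n : ℤ => hornCoeff A C n * x ^ n) (hornSum A C x) (conditional ℤ) := by
  have hx0 : x ≠ 0 := by rintro rfl; simp at hx
  have h1 : 1 - x ≠ 0 := sub_ne_zero.2 hx1.symm
  have hC0 : C ≠ 0 := by simpa using hC 0
  have hCA : C - A ≠ 0 := fun h0 => by simp [h0] at h
  have hC' : ∀ j : ℕ, C + 1 ≠ -j := fun j hj => hC (j + 1) (by push_cast; linear_combination hj)
  have hsum := hasSum_hornCoeff_of_one_lt hA hC' (x := x)
    (by rw [add_sub_right_comm, add_re, one_re]; linarith) hx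
  have hshift : HasSum (fun n : ℤ => hornCoeff A (C + 1) (n - 1) * x ^ (n - 1))
      (hornSum A (C + 1) x) := by
    simpa only [Function.comp_def, Equiv.subRight_apply] using
      ((Equiv.subRight (1 : ℤ)).hasSum_iff
        (f := fun n : ℤ => hornCoeff A (C + 1) n * x ^ n)).2 hsum
  have hcond := ((hshift.mul_left x).mul_left ((A - C) / C)).conditional_int
  rw [← hornSum_eq_hornSum_add_one hC0 hCA hx0 hx1] at hcond
  have hnorm : ∀ {l : Filter ℤ}, Tendsto (hornCoeff A C) l (𝓝 0) →
      Tendsto (fun n : ℤ => hornCoeff A C n * x ^ n) l (𝓝 0) := fun hl => by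
    rw [tendsto_zero_iff_norm_tendsto_zero] at hl ⊢
    simpa [hx] using hl
  -- The two boundary terms of the telescoped sum; they vanish because the coefficients tend to `0`
  -- at both ends.
  have hbd : Tendsto (fun q : ℤ × ℤ => x * (hornCoeff A C q.2 * x ^ q.2) -
      x * (hornCoeff A C (q.1 - 1) * x ^ (q.1 - 1))) (atBot ×ˢ atTop) (𝓝 0) := by
    have ht := (hnorm (tendsto_hornCoeff_atTop hA hC h)).comp
      (tendsto_snd (f := (atBot : Filter ℤ)))
    have hb := ((hnorm (tendsto_hornCoeff_atBot hA hC h)).comp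
      (tendsto_atBot_add_const_right atBot (-1 : ℤ) tendsto_id)).comp
      (tendsto_fst (g := (atTop : Filter ℤ)))
    simpa [Function.comp_def, ← sub_eq_add_neg] using (ht.const_mul x).sub (hb.const_mul x)
  rw [HasSum, conditional_filter, tendsto_map'_iff] at hcond ⊢
  have key := (hcond.sub hbd).const_mul (1 - x)⁻¹
  rw [sub_zero, inv_mul_cancel_left₀ h1] at key
  refine key.congr' ?_
  filter_upwards [(eventually_le_atBot (0 : ℤ)).prod_mk (eventually_ge_atTop (0 : ℤ))] with q hq
  rw [inv_mul_eq_iff_eq_mul₀ h1, Function.comp_apply, Function.comp_apply,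
    ← sum_Icc_sub_shift (fun n => x * (hornCoeff A C n * x ^ n)) (hq.1.trans hq.2),
    ← Finset.sum_sub_distrib, Finset.mul_sum]
  refine Finset.sum_congr rfl fun n _ => ?_
  have hd := hornCoeff_sub_hornCoeff (A := A) hC0 n
  have hz : x ^ n = x ^ (n - 1) * x := by rw [← zpow_add_one₀ hx0, sub_add_cancel]
  rw [hz]
  linear_combination -x ^ (n - 1) * x * hd

theorem hasSum_conditional_hornCoeff' {A C x : ℂ} (hA : ∀ j : ℕ, A ≠ j + 1)
    (hC : ∀ j : ℕ, C ≠ -j) (hx : ‖x‖ = 1) (h : 1 < (C - A).re ∨ (0 < (C - A).re ∧ x ≠ 1)) :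
    HasSum (fun n : ℤ => hornCoeff A C n * x ^ n) (hornSum A C x) (conditional ℤ) := by
  rcases h with h | h
  · exact (hasSum_hornCoeff_of_one_lt hA hC h hx).conditional_int
  · exact hasSum_conditional_hornCoeff hA hC hx h.1 h.2

/-! ### Duplication and the even part -/

theorem shiftedFactorial_eq (A : ℂ) (hA : ∀ j : ℕ, A ≠ j + 1) (n : ℤ) :
    shiftedFactorial A n = (-1) ^ n * (Gamma (1 - A) * (Gamma (1 - A - n))⁻¹) := by
  have hA' : ∀ j : ℕ, 1 - A ≠ -j := fun m hm => hA m (by linear_combination -hm)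
  have h0 : Gamma (1 - A) ≠ 0 := Complex.Gamma_ne_zero hA'
  have hprod : ∀ (n : ℕ) (g : ℕ → ℂ), ∏ i ∈ Finset.range n, -g i =
      (-1) ^ n * ∏ i ∈ Finset.range n, g i := fun n g => by
    rw [Finset.prod_neg, Finset.card_range]
  cases n with
  | ofNat n =>
    simp only [shiftedFactorial, Int.ofNat_eq_natCast, Int.cast_natCast, zpow_natCast]
    rw [inv_Gamma_sub_natCast, mul_comm (∏ i ∈ _, _), mul_inv_cancel_left₀ h0, ← hprod]
    exact Finset.prod_congr rfl fun i _ => by ring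
  | negSucc n =>
    simp only [shiftedFactorial, Int.cast_negSucc, zpow_negSucc, sub_neg_eq_add]
    rw [Gamma_mul_inv_Gamma_add_natCast hA', ← mul_inv, ← hprod]
    congr 1
    exact Finset.prod_congr rfl fun i _ => by ring

/-- Positive integers `C` are allowed: where `C + n` is a pole of `Gamma`, both sides are `0` by the
convention `0⁻¹ = 0`. -/
theorem inv_shiftedFactorial_eq (C : ℂ) (hC : ∀ j : ℕ, C ≠ -j) (n : ℤ) :
    (shiftedFactorial C n)⁻¹ = Gamma C * (Gamma (C + n))⁻¹ := by
  have h0 : Gamma C ≠ 0 := Complex.Gamma_ne_zero hC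
  cases n with
  | ofNat n =>
    simp only [shiftedFactorial, Int.ofNat_eq_natCast, Int.cast_natCast]
    rw [Gamma_mul_inv_Gamma_add_natCast hC]
  | negSucc n =>
    simp only [shiftedFactorial, Int.cast_negSucc, ← sub_eq_add_neg, inv_inv]
    rw [inv_Gamma_sub_natCast, mul_comm (∏ i ∈ _, _), mul_inv_cancel_left₀ h0]

theorem inv_Gamma_mul_inv_Gamma_add_half (s : ℂ) :
    (Gamma s)⁻¹ * (Gamma (s + 1 / 2))⁻¹ =
      (Gamma (2 * s))⁻¹ * 2 ^ (2 * s) * (2 * (Real.sqrt Real.pi : ℂ))⁻¹ := by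
  rw [← mul_inv, Complex.Gamma_mul_Gamma_add_half, Complex.cpow_sub _ _ two_ne_zero,
    Complex.cpow_one]
  simp only [mul_inv, inv_div]
  ring

theorem bilateralTerm_eq_hornCoeff {a c : ℂ} (ha : ∀ j : ℕ, 2 * a ≠ j + 1)
    (hc : ∀ j : ℕ, 2 * c ≠ -j) (z : ℂ) (m : ℤ) :
    bilateralTerm a (a + 1 / 2) c (c + 1 / 2) z m =
      hornCoeff (2 * a) (2 * c) (2 * m) * z ^ m := by
  have ha1 : ∀ j : ℕ, a ≠ j + 1 := fun j hj => ha (2 * j + 1) (by push_cast; rw [hj]; ring)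
  have ha2 : ∀ j : ℕ, a + 1 / 2 ≠ j + 1 := fun j hj =>
    ha (2 * j) (by push_cast; linear_combination 2 * hj)
  have hc1 : ∀ j : ℕ, c ≠ -j := fun j hj => hc (2 * j) (by push_cast; rw [hj]; ring)
  have hc2 : ∀ j : ℕ, c + 1 / 2 ≠ -j := fun j hj =>
    hc (2 * j + 1) (by push_cast; linear_combination 2 * hj)
  have hpi : (Real.sqrt Real.pi : ℂ) ≠ 0 := by
    exact_mod_cast (Real.sqrt_pos.2 Real.pi_pos).ne'
  have hpow : ∀ s : ℂ, (2 : ℂ) ^ s ≠ 0 := fun s => by simp [Complex.cpow_eq_zero_iff]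
  have hsign : ((-1 : ℂ) ^ m) * (-1) ^ m = 1 := by rw [← mul_zpow]; simp
  have hsign2 : (-1 : ℂ) ^ (2 * m) = 1 := by rw [zpow_mul]; simp
  have d1 := Complex.Gamma_mul_Gamma_add_half (1 / 2 - a)
  have d2 := inv_Gamma_mul_inv_Gamma_add_half (1 / 2 - a - m)
  have d3 := Complex.Gamma_mul_Gamma_add_half c
  have d4 := inv_Gamma_mul_inv_Gamma_add_half (c + m)
  -- The powers of `2` from the four duplications collapse to `4`, cancelling the two factors `1 /
  -- 2` in `d2` and `d4`.
  have e1 : (2 : ℂ) ^ (1 - 2 * (1 / 2 - a)) * 2 ^ (2 * (1 / 2 - a - m)) *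
      (2 ^ (1 - 2 * c) * 2 ^ (2 * (c + m))) = 4 := by
    rw [← Complex.cpow_add _ _ two_ne_zero, ← Complex.cpow_add _ _ two_ne_zero,
      ← Complex.cpow_add _ _ two_ne_zero, show (4 : ℂ) = 2 ^ (2 : ℂ) by norm_num]
    congr 1; ring
  rw [bilateralTerm, div_eq_mul_inv, mul_inv, shiftedFactorial_eq a ha1,
    shiftedFactorial_eq _ ha2, inv_shiftedFactorial_eq c hc1, inv_shiftedFactorial_eq _ hc2,
    hornCoeff, hsign2]
  congr 1
  rw [show 1 / 2 - a + 1 / 2 = 1 - a by ring, show 2 * (1 / 2 - a) = 1 - 2 * a by ring] at d1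
  rw [show 1 / 2 - a - m + 1 / 2 = 1 - a - m by ring,
    show 2 * (1 / 2 - a - (m : ℂ)) = 1 - 2 * a - 2 * m by ring] at d2
  rw [show c + m + 1 / 2 = c + 1 / 2 + (m : ℂ) by ring,
    show 2 * (c + (m : ℂ)) = 2 * c + 2 * m by ring] at d4
  rw [show 2 * (1 / 2 - a - (m : ℂ)) = 1 - 2 * a - 2 * m by ring,
    show 2 * (1 / 2 - a) = 1 - 2 * a by ring, show 2 * (c + (m : ℂ)) = 2 * c + 2 * m by ring] at e1
  rw [show 1 - (a + 1 / 2) = 1 / 2 - a by ring]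
  push_cast
  trans (((-1 : ℂ) ^ m) * (-1) ^ m) * (Gamma (1 / 2 - a) * Gamma (1 - a)) *
    (Gamma c * Gamma (c + 1 / 2)) * ((Gamma (1 / 2 - a - m))⁻¹ * (Gamma (1 - a - m))⁻¹) *
    ((Gamma (c + m))⁻¹ * (Gamma (c + 1 / 2 + m))⁻¹)
  · ring
  · rw [hsign, d1, d2, d3, d4]
    trans Gamma (2 * c) * Gamma (1 - 2 * a) *
      ((Gamma (2 * c + 2 * m))⁻¹ * (Gamma (1 - 2 * a - 2 * m))⁻¹) *
      ((2 : ℂ) ^ (1 - (1 - 2 * a)) * 2 ^ (1 - 2 * a - 2 * m) *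
      (2 ^ (1 - 2 * c) * 2 ^ (2 * c + 2 * m))) / 4 * ((Real.sqrt Real.pi : ℂ) *
        (Real.sqrt Real.pi : ℂ)⁻¹) ^ 2
    · rw [mul_inv]; ring
    · rw [e1, mul_inv_cancel₀ hpi]; ring

/-- Odd powers cancel between `s` and `-s`, and even ones double. The endpoints are even, so the
even indices are exactly `2 * m` with `m` in `Icc a b`. -/
theorem sum_Icc_two_mul (g : ℤ → ℂ) (s : ℂ) (a b : ℤ) :
    ∑ n ∈ Finset.Icc (2 * a) (2 * b), (g n * s ^ n + g n * (-s) ^ n) =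
      2 * ∑ m ∈ Finset.Icc a b, g (2 * m) * (s ^ 2) ^ m := by
  have hinj : Function.Injective fun m : ℤ => 2 * m := mul_right_injective₀ two_ne_zero
  rw [Finset.mul_sum]
  trans ∑ n ∈ (Finset.Icc a b).image (fun m : ℤ => 2 * m), (g n * s ^ n + g n * (-s) ^ n)
  · symm
    refine Finset.sum_subset ?_ ?_
    · intro n hn
      simp only [Finset.mem_image, Finset.mem_Icc] at hn ⊢
      omega
    · intro n hn hn'
      have hodd : Odd n := by
        by_contra he
        obtain ⟨k, hk⟩ := Int.not_odd_iff_even.1 he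
        apply hn'
        simp only [Finset.mem_image, Finset.mem_Icc] at hn ⊢
        exact ⟨k, by omega, by omega⟩
      rw [hodd.neg_zpow]; ring
  · rw [Finset.sum_image hinj.injOn]
    refine Finset.sum_congr rfl fun m _ => ?_
    rw [(even_two_mul m).neg_zpow, zpow_mul]
    norm_cast
    ring

theorem hasSum_bilateralTerm {a c s : ℂ} (hs : ‖s‖ = 1) (ha : ∀ j : ℕ, 2 * a ≠ j + 1)
    (hc : ∀ j : ℕ, 2 * c ≠ -j)
    (hac : 1 / 2 < (c - a).re ∨ (0 < (c - a).re ∧ s ^ 2 ≠ 1)) :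
    HasSum (bilateralTerm a (a + 1 / 2) c (c + 1 / 2) (s ^ 2))
      ((hornSum (2 * a) (2 * c) s + hornSum (2 * a) (2 * c) (-s)) / 2) (conditional ℤ) := by
  have hre : (2 * c - 2 * a).re = 2 * (c - a).re := by simp; ring
  -- If `s ^ 2 ≠ 1`, neither `s` nor `-s` equals `1`, so both binomial series converge.
  have hcond : ∀ x : ℂ, x ^ 2 = s ^ 2 →
      (1 < (2 * c - 2 * a).re ∨ (0 < (2 * c - 2 * a).re ∧ x ≠ 1)) := by
    intro x hx
    rw [hre]
    refine hac.imp (fun h => by linarith) fun h => ⟨by linarith [h.1], ?_⟩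
    rintro rfl
    exact h.2 (by rw [← hx, one_pow])
  have h1 := hasSum_conditional_hornCoeff' ha hc hs (hcond s rfl)
  have h2 := hasSum_conditional_hornCoeff' ha hc (x := -s) (by rwa [norm_neg])
    (hcond (-s) (neg_sq s))
  have h3 := h1.add h2
  rw [HasSum, conditional_filter, tendsto_map'_iff] at h3 ⊢
  -- Doubling both cutoffs keeps them independent and unbounded, so the limit may be taken along
  -- even cutoffs.
  have hb : Tendsto (fun n : ℤ => 2 * n) atBot atBot :=
    tendsto_atBot_mono' _ ((eventually_le_atBot (0 : ℤ)).mono fun n hn => by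
      simp only [id]; omega) tendsto_id
  have ht : Tendsto (fun n : ℤ => 2 * n) atTop atTop :=
    (tendsto_id (α := ℤ)).const_mul_atTop' two_pos
  refine ((h3.comp (hb.prodMap ht)).div_const 2).congr fun q => ?_
  simp only [Function.comp_apply, Prod.map_fst, Prod.map_snd, sum_Icc_two_mul,
    bilateralTerm_eq_hornCoeff ha hc]
  ring

theorem mainTheorem1 (a c z : ℂ) (hz : ‖z‖ = 1)
    (ha : ∀ j : ℕ, 2 * a ≠ (j : ℂ) + 1)
    (hc : ∀ j : ℕ, 2 * c ≠ -(j : ℂ))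
    (hac : 1 / 2 < (c - a).re ∨ (0 < (c - a).re ∧ z ≠ 1)) :
    Summable (bilateralTerm a (a + 1 / 2) c (c + 1 / 2) z) (SummationFilter.conditional ℤ) ∧
    (1 / 2 < (c - a).re →
      Summable fun m : ℤ => ‖bilateralTerm a (a + 1 / 2) c (c + 1 / 2) z m‖) ∧
    ∀ s : ℂ, s ^ 2 = z →
      bilateralH a (a + 1 / 2) c (c + 1 / 2) z =
        Complex.Gamma (2 * c) * Complex.Gamma (1 - 2 * a) / (2 * Complex.Gamma (2 * c - 2 * a)) *
          ((1 + s) ^ (2 * c - 2 * a - 1) / s ^ (2 * c - 1) +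
            (1 - s) ^ (2 * c - 2 * a - 1) / (-s) ^ (2 * c - 1)) := by
  have hsq : ∀ s : ℂ, s ^ 2 = z → ‖s‖ = 1 := fun s hs => by
    rw [← hs, norm_pow] at hz
    exact (pow_eq_one_iff_of_nonneg (norm_nonneg s) two_ne_zero).1 hz
  refine ⟨?_, fun h => ?_, fun s hs => ?_⟩
  · obtain ⟨s, rfl⟩ := IsAlgClosed.exists_pow_nat_eq z two_pos
    exact (hasSum_bilateralTerm (hsq s rfl) ha hc hac).summable
  · have hsum := summable_hornCoeff ha hc (by simp at h ⊢; linarith)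
    have hinj : Function.Injective fun m : ℤ => 2 * m := mul_right_injective₀ two_ne_zero
    refine (hsum.comp_injective hinj).norm.congr fun m => ?_
    simp only [Function.comp_apply, bilateralTerm_eq_hornCoeff ha hc, norm_mul, norm_zpow, hz,
      one_zpow, mul_one]
  · subst hs
    rw [bilateralH, (hasSum_bilateralTerm (hsq s rfl) ha hc hac).tsum_eq, hornSum, hornSum,
      sub_neg_eq_add, neg_neg, mul_comm (2 : ℂ) (Gamma _), ← div_div]
    ring
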